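/- **(A)** Let $(\Omega,\nu)$ be a $\sigma$-finite measure space, $\mathcal H$ a separable complex Hilbert space, and $D\subseteq L^\infty(\Omega)$ a determining set for $L^1(\Omega)$, i.e. $f\in L^1(\Omega)$ and $\int_\Omega fg\,d\nu=0$ for all $g\in D$ imply $f=0$. For $S\subseteq L^2(\Omega,\mathcal H)$ put $M_D(S)=\overline{\mathrm{span}}\{g\Phi:\Phi\in S,\ g\in D\}$. Let $M\subseteq L^2(\Omega,\mathcal H)$ be a closed subspace with $g\Phi\in M$ for all $\Phi\in M$, $g\in D$ (an MI space), finitely generated in the sense that $M=M_D(S)$ for some finite $S$. Let $J$ be its range function, i.e. a map from $\Omega$ to the closed subspaces of $\mathcal H$ such that $\omega\mapsto P_{J(\omega)}a$ is measurable for every $a\in\mathcal H$ ($P_{J(\omega)}$ the orthogonal projection onto $J(\omega)$) and $M=\{\Phi\in L^2(\Omega,\mathcal H):\Phi(\omega)\in J(\omega)\text{ for a.e. }\omega\}$. Then the length $$\ell(M)=\min\{n\ge 0:\ \exists\,\Phi_1,\dots,\Phi_n\in M\text{ with }M=M_D(\Phi_1,\dots,\Phi_n)\}$$ satisfies $\ell(M)=\operatorname{ess\,sup}_{\omega\in\Omega}\dim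 J(\omega)$. **(B)** Let $\Gamma$ be a countable discrete abelian group with compact dual group $\widehat\Gamma$, carrying its Haar measure of total mass $1$; write $(\gamma,\alpha)$ for the value of $\alpha\in\widehat\Gamma$ at $\gamma$. Let $(\mathcal X,\mu)$ be a $\sigma$-finite measure space with $L^2(\mathcal X)$ separable. Let $\sigma$ be an action of $\Gamma$ on $\mathcal X$ by measurable maps $\sigma_\gamma$ which is quasi-$\Gamma$-invariant, i.e. $d\mu(\sigma_\gamma(x))=J_\sigma(\gamma,x)\,d\mu(x)$ with a measurable $J_\sigma>0$. Let $C\subseteq\mathcal X$ be a measurable tiling set: $\mu(\sigma_\gamma(C)\cap\sigma_{\gamma'}(C))=0$ for $\gamma\ne\gamma'$ and $\mu(\mathcal X\setminus\bigcup_\gamma\sigma_\gamma(C))=0$. Put $\Pi_\sigma(\gamma)\psi(x)=J_\sigma(-\gamma,x)^{1/2}\psi(\sigma_{-\gamma}(x))$ for $\psi\in L^2(\mathcal X)$, and let $Z_\sigma:L^2(\mathcal X)\to L^2(\widehat\Gamma,L^2(C))$ be the Zak transform, $$Z_\sigma[\psi](\alpha)(x)=\sum_{\gamma\in\Gamma}\bigl[\Pi_\sigma(\gamma)\psi(x)\bigr](-\gamma,\alpha)$$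 (the series converging in $L^2(\widehat\Gamma,L^2(C))$). For $\mathcal A\subseteq L^2(\mathcal X)$ put $S_\sigma^\Gamma(\mathcal A)=\overline{\mathrm{span}}\{\Pi_\sigma(\gamma)\phi:\phi\in\mathcal A,\ \gamma\in\Gamma\}$. Let $V\subseteq L^2(\mathcal X)$ be a closed subspace with $\Pi_\sigma(\gamma)V\subseteq V$ for all $\gamma$, with $V=S_\sigma^\Gamma(\mathcal A)$ for some finite $\mathcal A$. Let $J$ be its range function, i.e. a map from $\widehat\Gamma$ to the closed subspaces of $L^2(C)$, measurable in the sense of (A), with $V=\{f\in L^2(\mathcal X):Z_\sigma[f](\alpha)\in J(\alpha)\text{ for a.e. }\alpha\}$. Then the length $$\ell(V)=\min\{n\ge 0:\ \exists\,\phi_1,\dots,\phi_n\in V\text{ with }V=S_\sigma^\Gamma(\phi_1,\dots,\phi_n)\}$$ satisfies $\ell(V)=\operatorname{ess\,sup}_{\alpha\in\widehat\Gamma}\dim J(\alpha)$. -/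

import Mathlib

open MeasureTheory
open scoped ENNReal

noncomputable section

/-! ### Range functions and multiplicatively invariant spaces in `L²(Ω, H)` -/

section MultiplicativelyInvariant

variable {Ω : Type*} [MeasurableSpace Ω] {ν : Measure Ω}
variable {H : Type*} [NormedAddCommGroup H] [InnerProductSpace ℂ H]

/-- The dimension of a closed subspace, as an element of `{0, 1, 2, …, ∞}`. -/
def closedDim (K : ClosedSubmodule ℂ H) : ℕ∞ :=
  Cardinal.toENat (Module.rank ℂ K.toSubmodule)

/-- The orthogonal projection of `H` onto a closed subspace, as a map `H → H`. -/
def closedProj [CompleteSpace H] (K : ClosedSubmodule ℂ H) : H →L[ℂ] H :=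
  haveI : CompleteSpace K.toSubmodule := K.isClosed.completeSpace_coe
  K.toSubmodule.starProjection

/-- A range function `J` is measurable if `ω ↦ P_{J(ω)} a` is measurable as a vector valued
function (that is, almost everywhere a limit of simple functions), for every vector `a`. -/
def MeasurableRangeFunction [CompleteSpace H] (J : Ω → ClosedSubmodule ℂ H)
    (ν : Measure Ω) : Prop :=
  ∀ a : H, AEStronglyMeasurable (fun ω => closedProj (J ω) a) ν

/-- `D ⊆ L^∞(Ω)` is a determining set for `L¹(Ω)`. -/
def IsDeterminingSet (D : Set (Lp ℂ ∞ ν)) : Prop :=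
  ∀ f : Lp ℂ 1 ν, (∀ g ∈ D, ∫ ω, f ω * g ω ∂ν = 0) → f = 0

/-- The closed subspace `M ⊆ L²(Ω, H)` is invariant under multiplication by the functions
in `D`. -/
def IsMultInvariant (D : Set (Lp ℂ ∞ ν)) (M : ClosedSubmodule ℂ (Lp H 2 ν)) : Prop :=
  ∀ Φ ∈ M, ∀ g ∈ D, (g • Φ : Lp H 2 ν) ∈ M

/-- `M_D(S)`: the closed linear span of the products `g Φ` with `Φ ∈ S` and `g ∈ D`. -/
def multGenerated (D : Set (Lp ℂ ∞ ν)) (S : Set (Lp H 2 ν)) : ClosedSubmodule ℂ (Lp H 2 ν) :=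
  (Submodule.span ℂ {Ψ : Lp H 2 ν | ∃ Φ ∈ S, ∃ g ∈ D, Ψ = g • Φ}).closure

/-- `M` is generated, as a multiplicatively invariant space, by finitely many functions. -/
def IsMultFinitelyGenerated (D : Set (Lp ℂ ∞ ν)) (M : ClosedSubmodule ℂ (Lp H 2 ν)) : Prop :=
  ∃ S : Set (Lp H 2 ν), S.Finite ∧ M = multGenerated D S

/-- The length of `M`: the least `n ≥ 0` such that `M = M_D(Φ₁, …, Φₙ)` for some
`Φ₁, …, Φₙ ∈ M` (and `∞` if there is no such `n`). -/
def multLength (D : Set (Lp ℂ ∞ ν)) (M : ClosedSubmodule ℂ (Lp H 2 ν)) : ℕ∞ :=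
  sInf {k : ℕ∞ | ∃ n : ℕ, k = n ∧ ∃ Φ : Fin n → Lp H 2 ν,
    (∀ i, Φ i ∈ M) ∧ M = multGenerated D (Set.range Φ)}

/-- `J` is a measurable range function with `M = {Φ : Φ(ω) ∈ J(ω) for a.e. ω}`. -/
def IsRangeFunctionOf [CompleteSpace H] (J : Ω → ClosedSubmodule ℂ H)
    (M : ClosedSubmodule ℂ (Lp H 2 ν)) : Prop :=
  MeasurableRangeFunction J ν ∧ ∀ Φ : Lp H 2 ν, Φ ∈ M ↔ ∀ᵐ ω ∂ν, Φ ω ∈ J ω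

end MultiplicativelyInvariant

/-! ### Quasi-invariant actions of a discrete abelian group -/

/-- A quasi-`Γ`-invariant action `σ` of `Γ` on the measure space `(X, μ)`, together with its
Jacobian `jac`, `dμ(σ_γ(x)) = jac(γ, x) dμ(x)`. -/
structure QuasiInvariantAction (Γ : Type*) [AddCommGroup Γ] {X : Type*} [MeasurableSpace X]
    (μ : Measure X) where
  act : Γ → X → X
  measurable_act : ∀ γ, Measurable (act γ)
  act_act : ∀ γ γ' x, act γ (act γ' x) = act (γ + γ') x
  act_zero : ∀ x, act 0 x = x
  jac : Γ → X → ℝ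
  measurable_jac : ∀ γ, Measurable (jac γ)
  jac_pos : ∀ γ x, 0 < jac γ x
  measure_image : ∀ γ (E : Set X), MeasurableSet E →
    μ (act γ '' E) = ∫⁻ x in E, ENNReal.ofReal (jac γ x) ∂μ

namespace QuasiInvariantAction

variable {Γ : Type*} [AddCommGroup Γ] {X : Type*} [MeasurableSpace X] {μ : Measure X}

/-- `C` is a tiling set for the action. -/
structure IsTilingSet (σ : QuasiInvariantAction Γ μ) (C : Set X) : Prop where
  measurableSet : MeasurableSet C
  disjoint : ∀ γ γ', γ ≠ γ' → μ (σ.act γ '' C ∩ σ.act γ' '' C) = 0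
  cover : μ (⋃ γ, σ.act γ '' C)ᶜ = 0

theorem preimage_act (σ : QuasiInvariantAction Γ μ) (γ : Γ) (E : Set X) :
    σ.act (-γ) ⁻¹' E = σ.act γ '' E := by
  ext x
  constructor
  · intro hx
    exact ⟨σ.act (-γ) x, hx, by rw [σ.act_act, add_neg_cancel, σ.act_zero]⟩
  · rintro ⟨y, hy, rfl⟩
    simpa [σ.act_act, σ.act_zero] using hy

theorem map_act (σ : QuasiInvariantAction Γ μ) (γ : Γ) :
    μ.map (σ.act (-γ)) = μ.withDensity (fun x => ENNReal.ofReal (σ.jac γ x)) := by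
  ext E hE
  rw [Measure.map_apply (σ.measurable_act _) hE, withDensity_apply _ hE, preimage_act,
    σ.measure_image γ E hE]

/-- The measure with density `jac (-γ)` is pushed forward to `μ` by `σ_{-γ}`. -/
theorem map_withDensity (σ : QuasiInvariantAction Γ μ) (γ : Γ) :
    (μ.withDensity (fun x => ENNReal.ofReal (σ.jac (-γ) x))).map (σ.act (-γ)) = μ := by
  rw [← σ.map_act (-γ), Measure.map_map (σ.measurable_act _) (σ.measurable_act _)]
  have : σ.act (-γ) ∘ σ.act (- -γ) = id := by
    funext x
    simp [σ.act_act, σ.act_zero]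
  rw [this, Measure.map_id]

theorem quasiMeasurePreserving_act (σ : QuasiInvariantAction Γ μ) (γ : Γ) :
    Measure.QuasiMeasurePreserving (σ.act (-γ)) μ μ :=
  ⟨σ.measurable_act _, by rw [σ.map_act]; exact withDensity_absolutelyContinuous _ _⟩

theorem memLp_rep (σ : QuasiInvariantAction Γ μ) (γ : Γ) (ψ : Lp ℂ 2 μ) :
    MemLp (fun x => (Real.sqrt (σ.jac (-γ) x) : ℂ) * ψ (σ.act (-γ) x)) 2 μ := by
  have hq := σ.quasiMeasurePreserving_act γ
  have hψ : AEStronglyMeasurable (fun x => ψ (σ.act (-γ) x)) μ :=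
    (Lp.aestronglyMeasurable ψ).comp_quasiMeasurePreserving hq
  have hJ : Measurable (fun x => ENNReal.ofReal (σ.jac (-γ) x)) :=
    (σ.measurable_jac _).ennreal_ofReal
  refine ⟨AEStronglyMeasurable.mul ?_ hψ, ?_⟩
  · exact (Complex.measurable_ofReal.comp
      (Real.continuous_sqrt.measurable.comp (σ.measurable_jac _))).aestronglyMeasurable
  rw [eLpNorm_lt_top_iff_lintegral_rpow_enorm_lt_top (by norm_num) (by norm_num)]
  have h1 := (eLpNorm_lt_top_iff_lintegral_rpow_enorm_lt_top (by norm_num) (by norm_num)).1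
    (Lp.memLp ψ).2
  have hm : AEMeasurable (fun x => ‖ψ x‖ₑ ^ (2 : ℝ≥0∞).toReal) μ :=
    (Lp.aestronglyMeasurable ψ).enorm.pow_const _
  obtain ⟨g, hg⟩ : ∃ g : X → ℂ, g = ⇑ψ := ⟨_, rfl⟩
  rw [← hg] at h1 hm hψ ⊢
  have hm' : AEMeasurable (fun x => ‖g x‖ₑ ^ (2 : ℝ≥0∞).toReal)
      ((μ.withDensity (fun x => ENNReal.ofReal (σ.jac (-γ) x))).map (σ.act (-γ))) := by
    rw [map_withDensity]; exact hm
  have h2 : ∫⁻ x, ‖g x‖ₑ ^ (2 : ℝ≥0∞).toReal ∂μ =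
      ∫⁻ x, ((fun x => ENNReal.ofReal (σ.jac (-γ) x)) *
        fun x => ‖g (σ.act (-γ) x)‖ₑ ^ (2 : ℝ≥0∞).toReal) x ∂μ := by
    rw [← lintegral_withDensity_eq_lintegral_mul₀ hJ.aemeasurable
      (hψ.enorm.pow_const (2 : ℝ≥0∞).toReal),
      ← lintegral_map' hm' (σ.measurable_act _).aemeasurable, map_withDensity]
  rw [h2] at h1
  refine lt_of_eq_of_lt (lintegral_congr fun x => ?_) h1
  have hp := σ.jac_pos (-γ) x
  simp only [Pi.mul_apply, enorm_mul, ENNReal.toReal_ofNat, ENNReal.rpow_ofNat, mul_pow]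
  congr 1
  rw [← ofReal_norm, ← ENNReal.ofReal_pow (norm_nonneg _), Complex.norm_real,
    Real.norm_eq_abs, sq_abs, Real.sq_sqrt hp.le]

/-- The unitary representation `Π_σ(γ)ψ(x) = jac(-γ, x)^{1/2} ψ(σ_{-γ}(x))` on `L²(X)`. -/
def rep (σ : QuasiInvariantAction Γ μ) (γ : Γ) (ψ : Lp ℂ 2 μ) : Lp ℂ 2 μ :=
  (σ.memLp_rep γ ψ).toLp _

/-- `(Γ, σ)`-invariance of a closed subspace of `L²(X)`. -/
def IsInvariant (σ : QuasiInvariantAction Γ μ) (V : ClosedSubmodule ℂ (Lp ℂ 2 μ)) : Prop :=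
  ∀ f ∈ V, ∀ γ, σ.rep γ f ∈ V

/-- The `(Γ, σ)`-invariant space generated by `A`: the closed linear span of the orbits. -/
def generated (σ : QuasiInvariantAction Γ μ) (A : Set (Lp ℂ 2 μ)) :
    ClosedSubmodule ℂ (Lp ℂ 2 μ) :=
  (Submodule.span ℂ {f : Lp ℂ 2 μ | ∃ φ ∈ A, ∃ γ, f = σ.rep γ φ}).closure

/-- `V` is generated, as a `(Γ, σ)`-invariant space, by finitely many functions. -/
def IsFinitelyGenerated (σ : QuasiInvariantAction Γ μ) (V : ClosedSubmodule ℂ (Lp ℂ 2 μ)) :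
    Prop :=
  ∃ A : Set (Lp ℂ 2 μ), A.Finite ∧ V = σ.generated A

/-- The length of `V`: the least `n ≥ 0` such that `V` is generated by some
`φ₁, …, φₙ ∈ V` (and `∞` if there is no such `n`). -/
def length (σ : QuasiInvariantAction Γ μ) (V : ClosedSubmodule ℂ (Lp ℂ 2 μ)) : ℕ∞ :=
  sInf {k : ℕ∞ | ∃ n : ℕ, k = n ∧ ∃ φ : Fin n → Lp ℂ 2 μ,
    (∀ i, φ i ∈ V) ∧ V = σ.generated (Set.range φ)}

end QuasiInvariantAction

/-! ### The dual group and the Zak transform -/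

/-- The dual group of the additive group `Γ`. -/
abbrev DualGroup (Γ : Type*) [AddCommGroup Γ] [TopologicalSpace Γ] : Type _ :=
  PontryaginDual (Multiplicative Γ)

section DualGroup

variable {Γ : Type*} [AddCommGroup Γ] [TopologicalSpace Γ]

instance : MeasurableSpace (DualGroup Γ) := borel _

instance : BorelSpace (DualGroup Γ) := ⟨rfl⟩

/-- The value `(γ, α)` of the character `α` at `γ`. -/
def pairing (γ : Γ) (α : DualGroup Γ) : ℂ := (α (Multiplicative.ofAdd γ) : Circle)

theorem continuous_pairing (γ : Γ) : Continuous (pairing γ : DualGroup Γ → ℂ) := by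
  have h : Continuous (fun α : Multiplicative Γ →ₜ* Circle => α (Multiplicative.ofAdd γ)) :=
    (ContinuousEvalConst.continuous_eval_const (F := C(Multiplicative Γ, Circle))
      (Multiplicative.ofAdd γ)).comp
      (ContinuousMonoidHom.isInducing_toContinuousMap (Multiplicative Γ) Circle).continuous
  exact continuous_subtype_val.comp h

variable [DiscreteTopology Γ]

variable (Γ) in
/-- The Haar measure of total mass `1` on the (compact) dual of the discrete group `Γ`. -/
def dualHaar : Measure (DualGroup Γ) := Measure.haarMeasure ⊤

instance : IsProbabilityMeasure (dualHaar Γ) := ⟨by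
  have h := Measure.haarMeasure_self (G := DualGroup Γ) (K₀ := ⊤)
  simpa [dualHaar] using h⟩

variable {E : Type*} [NormedAddCommGroup E] [NormedSpace ℂ E]

theorem memLp_pairing_smul (γ : Γ) (u : E) :
    MemLp (fun α : DualGroup Γ => pairing γ α • u) 2 (dualHaar Γ) := by
  refine MemLp.of_bound
    ((continuous_pairing γ).aestronglyMeasurable.smul_const u) ‖u‖ (.of_forall fun α => ?_)
  rw [norm_smul, pairing, Circle.norm_coe, one_mul]

/-- The element `α ↦ (γ, α) u` of `L²(Γ̂, E)`. -/
def pairingSMul (γ : Γ) (u : E) : Lp E 2 (dualHaar Γ) :=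
  (memLp_pairing_smul γ u).toLp _

namespace QuasiInvariantAction

variable {X : Type*} [MeasurableSpace X] {μ : Measure X}

/-- The Zak transform `L²(X) → L²(Γ̂, L²(C))`,
`Z_σ[ψ](α)(x) = ∑_γ [Π_σ(γ)ψ(x)] (-γ, α)` for `x ∈ C`.
For almost every `x ∈ C` the coefficients `Π_σ(γ)ψ(x)` are square summable, and the sum is their
`ℓ²`-Fourier transform, so the series is one in the norm of `L²`. As an element of
`L²(Γ̂, L²(C))` it is the sum of the functions `α ↦ (-γ, α) · (Π_σ(γ)ψ)|_C`. If `C` is a tiling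
set, these are pairwise orthogonal (distinct characters) and the sum of their squared norms is
`∑_γ ∫_{σ_{-γ}(C)} |ψ|² dμ = ‖ψ‖²`, so the series converges unconditionally. -/
def zak (σ : QuasiInvariantAction Γ μ) (C : Set X) (ψ : Lp ℂ 2 μ) :
    Lp (Lp ℂ 2 (μ.restrict C)) 2 (dualHaar Γ) :=
  ∑' γ : Γ, pairingSMul (-γ) (LpToLpRestrictCLM X ℂ ℂ μ 2 C (σ.rep γ ψ))

/-- `J` is a measurable range function with `V = {f : Z_σ[f](α) ∈ J(α) for a.e. α}`. -/
def IsZakRangeFunctionOf (σ : QuasiInvariantAction Γ μ) (C : Set X)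
    (J : DualGroup Γ → ClosedSubmodule ℂ (Lp ℂ 2 (μ.restrict C)))
    (V : ClosedSubmodule ℂ (Lp ℂ 2 μ)) : Prop :=
  MeasurableRangeFunction J (dualHaar Γ) ∧
    ∀ f : Lp ℂ 2 μ, f ∈ V ↔ ∀ᵐ α ∂(dualHaar Γ), σ.zak C f α ∈ J α

end QuasiInvariantAction

end DualGroup

end

noncomputable section

/-! ### Pointwise spans and range functions -/

section MultiplicativelyInvariant

open Filter Topology

variable {Ω : Type*} [MeasurableSpace Ω] {ν : Measure Ω}
variable {H : Type*} [NormedAddCommGroup H] [InnerProductSpace ℂ H]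

/-! For (A), generating `M` is a pointwise matter: finitely many elements of `M` generate it exactly
when their values span `J ω` for almost every `ω`. Generators span pointwise because
finite-dimensional spans are closed and survive `L²` limits (`IsRangeFunctionOf.ae_le_span`).
Conversely, an element of `M` orthogonal to all `g F i` is pointwise orthogonal to the `F i`,
because `D` is determining, hence to `J ω`, and so vanishes (`IsRangeFunctionOf.eq_multGenerated`).
Thus `n` generators force `dim J ω ≤ n`. If `dim J ω ≤ n` almost everywhere, any finite generating
family can be cut to `n` members: at each `ω` some `n` of them already span, and finitely many such
choices are glued measurably (`IsRangeFunctionOf.exists_fin_span`).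

For (B), the Zak transform is unitary and turns `Π_σ(γ)` into multiplication by the character `γ`
(`zak_surjective`, `zak_rep`). Characters form a determining set by uniqueness of Fourier
coefficients, so (A) applies to the image of `V`. -/

theorem closedProj_mem [CompleteSpace H] (K : ClosedSubmodule ℂ H) (a : H) :
    closedProj K a ∈ K := by
  have : CompleteSpace K.toSubmodule := K.isClosed.completeSpace_coe
  exact K.toSubmodule.starProjection_apply_mem a

theorem closedProj_eq_self [CompleteSpace H] {K : ClosedSubmodule ℂ H} {a : H} (ha : a ∈ K) :
    closedProj K a = a := by
  have : CompleteSpace K.toSubmodule := K.isClosed.completeSpace_coe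
  exact K.toSubmodule.starProjection_eq_self_iff.2 ha

theorem inner_sub_closedProj [CompleteSpace H] {K : ClosedSubmodule ℂ H} (a : H) {v : H}
    (hv : v ∈ K) : inner ℂ (a - closedProj K a) v = 0 := by
  have : CompleteSpace K.toSubmodule := K.isClosed.completeSpace_coe
  exact K.toSubmodule.starProjection_inner_eq_zero a v hv

theorem norm_closedProj_le [CompleteSpace H] (K : ClosedSubmodule ℂ H) (a : H) :
    ‖closedProj K a‖ ≤ ‖a‖ := by
  have : CompleteSpace K.toSubmodule := K.isClosed.completeSpace_coe
  exact K.toSubmodule.norm_starProjection_apply_le a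

/-- A property that holds almost everywhere on every set of finite measure holds almost
everywhere. -/
theorem ae_of_forall_finite_measure [SigmaFinite ν] {p : Ω → Prop}
    (h : ∀ E, MeasurableSet E → ν E < ∞ → ∀ᵐ ω ∂ν, ω ∈ E → p ω) : ∀ᵐ ω ∂ν, p ω := by
  have h' : ∀ n, ∀ᵐ ω ∂ν, ω ∈ spanningSets ν n → p ω := fun n =>
    h _ (measurableSet_spanningSets ν n) (measure_spanningSets_lt_top ν n)
  filter_upwards [ae_all_iff.2 h'] with ω hω
  obtain ⟨n, hn⟩ := Set.mem_iUnion.1 ((iUnion_spanningSets ν).symm ▸ Set.mem_univ ω :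
    ω ∈ ⋃ n, spanningSets ν n)
  exact hω n hn

theorem memLp_indicator_of_bound {H : Type*} [NormedAddCommGroup H] {f : Ω → H} (hf : AEStronglyMeasurable f ν) {c : ℝ}
    (hc : ∀ ω, ‖f ω‖ ≤ c) {E : Set Ω} (hE : MeasurableSet E) (hνE : ν E < ∞) :
    MemLp (E.indicator f) 2 ν := by
  rw [memLp_indicator_iff_restrict hE]
  have : IsFiniteMeasure (ν.restrict E) := ⟨by simpa using hνE⟩
  exact MemLp.of_bound hf.restrict c (.of_forall hc)

/-- A limit in `L²` of elements of a span inherits pointwise membership in closed subspaces. -/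
theorem ae_mem_of_mem_closure_span {K : Ω → Submodule ℂ H}
    (hK : ∀ᵐ ω ∂ν, IsClosed (K ω : Set H)) {T : Set (Lp H 2 ν)}
    (hT : ∀ Φ ∈ T, ∀ᵐ ω ∂ν, Φ ω ∈ K ω) {Ψ : Lp H 2 ν}
    (hΨ : Ψ ∈ (Submodule.span ℂ T).closure) : ∀ᵐ ω ∂ν, Ψ ω ∈ K ω := by
  have hspan : ∀ Φ ∈ Submodule.span ℂ T, ∀ᵐ ω ∂ν, Φ ω ∈ K ω := by
    intro Φ hΦ
    induction hΦ using Submodule.span_induction with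
    | mem x hx => exact hT x hx
    | zero =>
      filter_upwards [Lp.coeFn_zero H 2 ν] with ω hω
      rw [hω]; exact (K ω).zero_mem
    | add x y _ _ hx hy =>
      filter_upwards [hx, hy, Lp.coeFn_add x y] with ω h1 h2 h3
      rw [h3]; exact (K ω).add_mem h1 h2
    | smul c x _ hx =>
      filter_upwards [hx, Lp.coeFn_smul c x] with ω h1 h2
      rw [h2]; exact (K ω).smul_mem c h1
  have hΨ' : Ψ ∈ closure (Submodule.span ℂ T : Set (Lp H 2 ν)) := hΨ
  obtain ⟨u, hu, hlim⟩ := mem_closure_iff_seq_limit.1 hΨ'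
  obtain ⟨ns, -, hns⟩ := (tendstoInMeasure_of_tendsto_Lp hlim).exists_seq_tendsto_ae
  filter_upwards [hK, hns, ae_all_iff.2 fun n => hspan _ (hu n)] with ω h1 h2 h3
  exact h1.mem_of_tendsto h2 (.of_forall fun i => h3 (ns i))

theorem IsDeterminingSet.ae_eq_zero {D : Set (Lp ℂ ∞ ν)} (hD : IsDeterminingSet D) {f : Ω → ℂ}
    (hf : Integrable f ν) (h : ∀ g ∈ D, ∫ ω, f ω * g ω ∂ν = 0) : f =ᵐ[ν] 0 := by
  have h0 : hf.toL1 f = 0 := by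
    refine hD _ fun g hg => ?_
    rw [← h g hg]
    refine integral_congr_ae ?_
    filter_upwards [hf.coeFn_toL1] with ω hω
    rw [hω]
  filter_upwards [hf.coeFn_toL1, (Lp.eq_zero_iff_ae_eq_zero).1 h0] with ω h1 h2
  rw [← h1, h2]

/-- If `Ψ` is orthogonal to `g Φ` for all `g` in a determining set, then `Ψ` and `Φ` are
pointwise orthogonal. -/
theorem IsDeterminingSet.ae_inner_eq_zero {D : Set (Lp ℂ ∞ ν)} (hD : IsDeterminingSet D)
    {Φ Ψ : Lp H 2 ν} (h : ∀ g ∈ D, inner ℂ Ψ (g • Φ : Lp H 2 ν) = 0) :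
    ∀ᵐ ω ∂ν, inner ℂ (Ψ ω) (Φ ω) = 0 := by
  refine hD.ae_eq_zero (L2.integrable_inner Ψ Φ) fun g hg => ?_
  rw [← h g hg, L2.inner_def]
  refine integral_congr_ae ?_
  filter_upwards [Lp.coeFn_lpSMul (r := 2) g Φ] with ω hω
  rw [hω, Pi.smul_apply', inner_smul_right, mul_comm]

theorem smul_mem_multGenerated {D : Set (Lp ℂ ∞ ν)} {S : Set (Lp H 2 ν)} {Φ : Lp H 2 ν}
    (hΦ : Φ ∈ S) {g : Lp ℂ ∞ ν} (hg : g ∈ D) : (g • Φ : Lp H 2 ν) ∈ multGenerated D S :=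
  subset_closure (Submodule.subset_span ⟨Φ, hΦ, g, hg, rfl⟩)

/-- Functions whose `D`-multiples have values in `J` have values in `J`. -/
theorem IsRangeFunctionOf.mem_of_smul_mem [CompleteSpace H] [TopologicalSpace.SeparableSpace H]
    [SigmaFinite ν] {D : Set (Lp ℂ ∞ ν)} (hD : IsDeterminingSet D)
    {M : ClosedSubmodule ℂ (Lp H 2 ν)} {J : Ω → ClosedSubmodule ℂ H}
    (hJ : IsRangeFunctionOf J M) {Φ : Lp H 2 ν} (h : ∀ g ∈ D, (g • Φ : Lp H 2 ν) ∈ M) :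
    Φ ∈ M := by
  have key : ∀ a : H, ∀ᵐ ω ∂ν, inner ℂ (a - closedProj (J ω) a) (Φ ω) = 0 := by
    intro a
    -- The field `a - P_{J(ω)} a` is bounded but need not be square integrable, so it is cut off to
    -- sets of finite measure.
    refine ae_of_forall_finite_measure fun E hE hνE => ?_
    have hm : AEStronglyMeasurable (fun ω => a - closedProj (J ω) a) ν :=
      aestronglyMeasurable_const.sub (hJ.1 a)
    have hL := memLp_indicator_of_bound hm (c := ‖a‖ + ‖a‖) (fun ω =>
      (norm_sub_le _ _).trans (add_le_add le_rfl (norm_closedProj_le _ _))) hE hνE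
    have h0 := hD.ae_inner_eq_zero (Φ := Φ) (Ψ := hL.toLp _) fun g hg => by
      rw [L2.inner_def]
      refine integral_eq_zero_of_ae ?_
      filter_upwards [hL.coeFn_toLp, (hJ.2 _).1 (h g hg)] with ω h1 h2
      rw [h1]
      by_cases hω : ω ∈ E
      · rw [Set.indicator_of_mem hω]; exact inner_sub_closedProj a h2
      · rw [Set.indicator_of_notMem hω]; simp
    filter_upwards [h0, hL.coeFn_toLp] with ω h1 h2 hω
    rwa [h2, Set.indicator_of_mem hω] at h1
  rw [hJ.2]
  -- The null set in `key` depends on `a`; a countable dense set and continuity in `a` give one null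
  -- set for all `a`, which permits the choice `a = Φ ω`.
  filter_upwards [ae_all_iff.2 fun n => key (TopologicalSpace.denseSeq H n)] with ω hω
  have hcont : Continuous fun a => inner ℂ (a - closedProj (J ω) a) (Φ ω) := by fun_prop
  have hall : ∀ a, inner ℂ (a - closedProj (J ω) a) (Φ ω) = 0 := by
    intro a
    have := (TopologicalSpace.denseRange_denseSeq H).equalizer hcont continuous_const
      (funext fun n => hω n)
    exact congrFun this a
  have h1 := hall (Φ ω)
  have h2 := inner_sub_closedProj (Φ ω) (closedProj_mem (J ω) (Φ ω))
  have h3 : inner ℂ (Φ ω - closedProj (J ω) (Φ ω)) (Φ ω - closedProj (J ω) (Φ ω)) = 0 := by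
    rw [inner_sub_right, h1, h2, sub_zero]
  rw [sub_eq_zero.1 (inner_self_eq_zero.1 h3)]
  exact closedProj_mem _ _

/-- Pointwise, generators of `M` span the values of the range function. -/
theorem IsRangeFunctionOf.ae_le_span [CompleteSpace H] [TopologicalSpace.SeparableSpace H]
    [SigmaFinite ν] {D : Set (Lp ℂ ∞ ν)} {M : ClosedSubmodule ℂ (Lp H 2 ν)}
    {J : Ω → ClosedSubmodule ℂ H} (hJ : IsRangeFunctionOf J M) {ι : Type*} [Finite ι]
    {F : ι → Lp H 2 ν} (hM : M = multGenerated D (Set.range F)) :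
    ∀ᵐ ω ∂ν, (J ω).toSubmodule ≤ Submodule.span ℂ (Set.range fun i => F i ω) := by
  have hclosed : ∀ ω, IsClosed (Submodule.span ℂ (Set.range fun i => F i ω) : Set H) := by
    intro ω
    have := FiniteDimensional.span_of_finite ℂ (Set.finite_range fun i => F i ω)
    exact Submodule.closed_of_finiteDimensional _
  have hval : ∀ Ψ ∈ M, ∀ᵐ ω ∂ν, Ψ ω ∈ Submodule.span ℂ (Set.range fun i => F i ω) := by
    intro Ψ hΨ
    rw [hM] at hΨ
    refine ae_mem_of_mem_closure_span (.of_forall hclosed) ?_ hΨ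
    rintro _ ⟨_, ⟨i, rfl⟩, g, -, rfl⟩
    filter_upwards [Lp.coeFn_lpSMul (r := 2) g (F i)] with ω hω
    rw [hω]
    exact Submodule.smul_mem _ _ (Submodule.subset_span ⟨i, rfl⟩)
  have key : ∀ a : H, ∀ᵐ ω ∂ν,
      closedProj (J ω) a ∈ Submodule.span ℂ (Set.range fun i => F i ω) := by
    intro a
    refine ae_of_forall_finite_measure fun E hE hνE => ?_
    -- The truncated fields `P_{J(ω)} a` are elements of `M`, and for `a` in a dense set their
    -- values recover all of `J ω`.
    have hL := memLp_indicator_of_bound (hJ.1 a) (c := ‖a‖) (fun ω => norm_closedProj_le _ _)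
      hE hνE
    have hmem : hL.toLp _ ∈ M := by
      rw [hJ.2]
      filter_upwards [hL.coeFn_toLp] with ω h1
      rw [h1]
      by_cases hω : ω ∈ E
      · rw [Set.indicator_of_mem hω]; exact closedProj_mem _ _
      · rw [Set.indicator_of_notMem hω]; exact (J ω).zero_mem
    filter_upwards [hval _ hmem, hL.coeFn_toLp] with ω h1 h2 hω
    rwa [h2, Set.indicator_of_mem hω] at h1
  filter_upwards [ae_all_iff.2 fun n => key (TopologicalSpace.denseSeq H n)] with ω hω v hv
  have hcl : IsClosed {a | closedProj (J ω) a ∈ Submodule.span ℂ (Set.range fun i => F i ω)} :=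
    (hclosed ω).preimage (closedProj (J ω)).continuous
  have hall : v ∈ {a | closedProj (J ω) a ∈ Submodule.span ℂ (Set.range fun i => F i ω)} := by
    refine hcl.closure_subset_iff.2 ?_ (TopologicalSpace.denseRange_denseSeq H v)
    rintro _ ⟨n, rfl⟩
    exact hω n
  rw [Set.mem_ofPred_eq, closedProj_eq_self hv] at hall
  exact hall

/-- Elements of `M` that pointwise span the values of the range function generate `M`. -/
theorem IsRangeFunctionOf.eq_multGenerated [CompleteSpace H] {D : Set (Lp ℂ ∞ ν)}
    (hD : IsDeterminingSet D) {M : ClosedSubmodule ℂ (Lp H 2 ν)} (hinv : IsMultInvariant D M)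
    {J : Ω → ClosedSubmodule ℂ H} (hJ : IsRangeFunctionOf J M) {ι : Type*} [Countable ι]
    {F : ι → Lp H 2 ν} (hF : ∀ i, F i ∈ M)
    (hspan : ∀ᵐ ω ∂ν, (J ω).toSubmodule ≤ Submodule.span ℂ (Set.range fun i => F i ω)) :
    M = multGenerated D (Set.range F) := by
  have hle : multGenerated D (Set.range F) ≤ M := by
    refine Submodule.closure_le.2 (Submodule.span_le.2 ?_)
    rintro _ ⟨_, ⟨i, rfl⟩, g, hg, rfl⟩
    exact hinv _ (hF i) g hg
  refine le_antisymm (fun Ψ hΨ => ?_) hle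
  set G := multGenerated D (Set.range F) with hG
  -- The defect of `Ψ` lies in `M` and is orthogonal to `G`; pointwise it is both in `J ω` and
  -- orthogonal to it.
  set Θ := Ψ - closedProj G Ψ with hΘ
  have hΘM : Θ ∈ M := M.toSubmodule.sub_mem hΨ (hle (closedProj_mem _ _))
  have horth : ∀ i, ∀ᵐ ω ∂ν, inner ℂ (Θ ω) (F i ω) = 0 := fun i =>
    hD.ae_inner_eq_zero fun g hg =>
      inner_sub_closedProj Ψ (smul_mem_multGenerated (Set.mem_range_self i) hg)
  have h0 : Θ = 0 := by
    rw [Lp.eq_zero_iff_ae_eq_zero]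
    filter_upwards [ae_all_iff.2 horth, hspan, (hJ.2 _).1 hΘM] with ω h1 h2 h3
    have h4 : Θ ω ∈ (Submodule.span ℂ {Θ ω})ᗮ := by
      have : Submodule.span ℂ (Set.range fun i => F i ω) ≤ (Submodule.span ℂ {Θ ω})ᗮ := by
        rw [Submodule.span_le]
        rintro _ ⟨i, rfl⟩
        exact Submodule.mem_orthogonal_singleton_iff_inner_right.2 (h1 i)
      exact this (h2 h3)
    exact inner_self_eq_zero.1 (Submodule.mem_orthogonal_singleton_iff_inner_right.1 h4)
  rw [sub_eq_zero.1 h0]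
  exact closedProj_mem _ _

theorem closedDim_le_of_le_span {K : ClosedSubmodule ℂ H} {n : ℕ} {v : Fin n → H}
    (h : K.toSubmodule ≤ Submodule.span ℂ (Set.range v)) : closedDim K ≤ n := by
  have h1 : Module.rank ℂ K.toSubmodule ≤ n := by
    refine (Submodule.rank_mono h).trans ((rank_span_le _).trans ?_)
    simpa using Cardinal.mk_range_le_lift (f := v)
  simpa [closedDim] using Cardinal.toENat_le_natCast.2 h1

end MultiplicativelyInvariant

/-! ### Measurable selection of a minimal number of generators, and part (A) -/

section MeasurableSelection

variable {Ω : Type*} [MeasurableSpace Ω] {ν : Measure Ω}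
variable {H : Type*} [NormedAddCommGroup H] [InnerProductSpace ℂ H]

/-- A finite-dimensional span is closed, and coefficients can be perturbed into a countable dense
set. The resulting condition involves only countable quantifiers, so it is measurable when `v` and
`x` vary with `ω`. -/
theorem mem_span_range_iff_denseSeq {n : ℕ} (v : Fin n → H) (x : H) :
    x ∈ Submodule.span ℂ (Set.range v) ↔ ∀ k : ℕ, ∃ q : ℕ,
      ‖x - ∑ j, TopologicalSpace.denseSeq (Fin n → ℂ) q j • v j‖ < 1 / ((k : ℝ) + 1) := by
  have hfin := FiniteDimensional.span_of_finite ℂ (Set.finite_range v)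
  have hclosed : IsClosed (Submodule.span ℂ (Set.range v) : Set H) :=
    Submodule.closed_of_finiteDimensional _
  constructor
  · intro hx k
    obtain ⟨c, rfl⟩ := (Submodule.mem_span_range_iff_exists_fun ℂ).1 hx
    have hcont : Continuous fun c' : Fin n → ℂ => ‖∑ j, c j • v j - ∑ j, c' j • v j‖ := by
      fun_prop
    have hopen := hcont.isOpen_preimage _ (isOpen_Iio (a := 1 / ((k : ℝ) + 1)))
    have hc : c ∈ (fun c' : Fin n → ℂ => ‖∑ j, c j • v j - ∑ j, c' j • v j‖) ⁻¹'
        Set.Iio (1 / ((k : ℝ) + 1)) := by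
      simp only [Set.mem_preimage, sub_self, norm_zero, Set.mem_Iio]
      positivity
    obtain ⟨q, hq⟩ := (TopologicalSpace.denseRange_denseSeq (Fin n → ℂ)).exists_mem_open
      hopen ⟨c, hc⟩
    exact ⟨q, hq⟩
  · intro h
    refine hclosed.closure_subset_iff.2 subset_rfl (Metric.mem_closure_iff.2 fun ε hε => ?_)
    obtain ⟨k, hk⟩ := exists_nat_one_div_lt hε
    obtain ⟨q, hq⟩ := h k
    refine ⟨∑ j, TopologicalSpace.denseSeq (Fin n → ℂ) q j • v j,
      Submodule.sum_mem _ fun j _ => Submodule.smul_mem _ _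
      (Submodule.subset_span ⟨j, rfl⟩), ?_⟩
    rw [dist_eq_norm]
    exact hq.trans hk

theorem measurableSet_mem_span {n : ℕ} {v : Fin n → Ω → H} {f : Ω → H}
    (hv : ∀ j, StronglyMeasurable (v j)) (hf : StronglyMeasurable f) :
    MeasurableSet {ω | f ω ∈ Submodule.span ℂ (Set.range fun j => v j ω)} := by
  simp_rw [mem_span_range_iff_denseSeq]
  have hset : {ω | ∀ k : ℕ, ∃ q : ℕ,
      ‖f ω - ∑ j, TopologicalSpace.denseSeq (Fin n → ℂ) q j • v j ω‖ < 1 / ((k : ℝ) + 1)} =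
      ⋂ k : ℕ, ⋃ q : ℕ, {ω |
        ‖f ω - ∑ j, TopologicalSpace.denseSeq (Fin n → ℂ) q j • v j ω‖ < 1 / ((k : ℝ) + 1)} := by
    ext ω; simp
  rw [hset]
  refine MeasurableSet.iInter fun k => MeasurableSet.iUnion fun q => measurableSet_lt ?_
    measurable_const
  refine (hf.sub ?_).norm.measurable
  exact Finset.stronglyMeasurable_fun_sum _ fun j _ => (hv j).const_smul _

/-- A finite family containing zero, of rank at most `n`, has the same span as a subfamily
indexed by `Fin n`. -/
theorem exists_fin_span_range_le {κ : Type*} [Finite κ] {n : ℕ} (v : κ → H) {o : κ}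
    (hn : Module.rank ℂ (Submodule.span ℂ (Set.range v)) ≤ n) :
    ∃ s : Fin n → κ, Submodule.span ℂ (Set.range v) ≤
      Submodule.span ℂ (Set.range fun j => v (s j)) := by
  obtain ⟨ι, a, ha, hspan, hli⟩ := exists_linearIndependent' ℂ v
  have hι : Finite ι := Finite.of_injective a ha
  have hcard : Nat.card ι ≤ n := by
    have hfin : Finite (Set.range (v ∘ a)) := Set.finite_range _
    rw [← hspan, rank_span hli, ← Nat.cast_card] at hn
    rw [← Nat.card_range_of_injective hli.injective]
    exact_mod_cast hn
  let e : ι → Fin n := fun i => Fin.castLE hcard (Finite.equivFin ι i)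
  have he : Function.Injective e := (Fin.castLE_injective hcard).comp (Equiv.injective _)
  -- Unused slots are filled with `o`; extra vectors can only enlarge the span.
  refine ⟨Function.extend e a fun _ => o, ?_⟩
  rw [← hspan]
  refine Submodule.span_mono ?_
  rintro _ ⟨i, rfl⟩
  exact ⟨e i, by simp [he.extend_apply]⟩

/-- There are finitely many ways to choose `n` indices from `κ`. Each choice spans on a measurable
set, and the rank bound makes these sets cover almost all of `Ω`. Using one choice on each piece of
a disjoint refinement gives `n` functions. -/
theorem IsRangeFunctionOf.exists_fin_span [CompleteSpace H]
    {M : ClosedSubmodule ℂ (Lp H 2 ν)}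
    {J : Ω → ClosedSubmodule ℂ H} (hJ : IsRangeFunctionOf J M) {κ : Type*} [Finite κ]
    {F : κ → Lp H 2 ν} (o : κ) (hF : ∀ i, F i ∈ M)
    (hspan : ∀ᵐ ω ∂ν, (J ω).toSubmodule ≤ Submodule.span ℂ (Set.range fun i => F i ω))
    {n : ℕ} (hn : ∀ᵐ ω ∂ν, closedDim (J ω) ≤ n) :
    ∃ Φ : Fin n → Lp H 2 ν, (∀ j, Φ j ∈ M) ∧
      ∀ᵐ ω ∂ν, (J ω).toSubmodule ≤ Submodule.span ℂ (Set.range fun j => Φ j ω) := by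
  have _ := Fintype.ofFinite κ
  -- Numbering the choices supplies the order in which `disjointed` lets the first successful choice
  -- win.
  obtain ⟨N, ⟨e⟩⟩ := Finite.exists_equiv_fin (Fin n → κ)
  let A : Fin N → Set Ω := fun l =>
    ⋂ i, {ω | F i ω ∈ Submodule.span ℂ (Set.range fun j => F (e.symm l j) ω)}
  have hA : ∀ l, MeasurableSet (A l) := fun l => MeasurableSet.iInter fun i =>
    measurableSet_mem_span (fun j => Lp.stronglyMeasurable _) (Lp.stronglyMeasurable _)
  let B : Fin N → Set Ω := disjointed A
  have hB : ∀ l, MeasurableSet (B l) := fun l =>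
    disjointedRec (fun _ _ ht => ht.diff (hA _)) (hA l)
  have hmem : ∀ j, MemLp (fun ω => ∑ l, (B l).indicator (F (e.symm l j)) ω) 2 ν := fun j =>
    memLp_finsetSum _ fun l _ => (Lp.memLp _).indicator (hB l)
  refine ⟨fun j => (hmem j).toLp _, fun j => ?_, ?_⟩
  · rw [hJ.2]
    filter_upwards [(hmem j).coeFn_toLp, ae_all_iff.2 fun i => (hJ.2 _).1 (hF i)] with ω h1 h2
    rw [h1]
    refine (J ω).toSubmodule.sum_mem fun l _ => ?_
    by_cases hω : ω ∈ B l
    · rw [Set.indicator_of_mem hω]; exact h2 _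
    · rw [Set.indicator_of_notMem hω]; exact (J ω).zero_mem
  · filter_upwards [ae_all_iff.2 fun j => (hmem j).coeFn_toLp,
      ae_all_iff.2 fun i => (hJ.2 _).1 (hF i), hspan, hn] with ω h1 h2 h3 h4
    have heq : Submodule.span ℂ (Set.range fun i => F i ω) = (J ω).toSubmodule :=
      le_antisymm (Submodule.span_le.2 (by rintro _ ⟨i, rfl⟩; exact h2 i)) h3
    have hrank : Module.rank ℂ (Submodule.span ℂ (Set.range fun i => F i ω)) ≤ n := by
      rw [heq]
      exact Cardinal.toENat_le_natCast.1 h4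
    obtain ⟨s, hs⟩ := exists_fin_span_range_le (fun i => F i ω) (o := o) hrank
    have hωA : ω ∈ ⋃ l, A l := by
      refine Set.mem_iUnion.2 ⟨e s, Set.mem_iInter.2 fun i => ?_⟩
      simpa using hs (Submodule.subset_span ⟨i, rfl⟩)
    have hωB : ω ∈ ⋃ l, B l := by
      have : (⋃ l, B l) = ⋃ l, A l := iUnion_disjointed
      rwa [this]
    obtain ⟨l, hl⟩ := Set.mem_iUnion.1 hωB
    have hval : ∀ j, (hmem j).toLp _ ω = F (e.symm l j) ω := by
      intro j
      rw [h1 j, Finset.sum_eq_single l, Set.indicator_of_mem hl]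
      · intro l' _ hne
        exact Set.indicator_of_notMem (fun h => Set.disjoint_left.1
          (disjoint_disjointed A hne) h hl) _
      · simp
    have hlA : ω ∈ A l := disjointed_le A l hl
    refine h3.trans ?_
    rw [Submodule.span_le]
    rintro _ ⟨i, rfl⟩
    simp_rw [hval]
    exact Set.mem_iInter.1 hlA i

/-- The length of a finitely generated multiplicatively invariant space is the essential
supremum of the dimensions of its range function. -/
theorem multLength_eq_essSup [CompleteSpace H] [TopologicalSpace.SeparableSpace H]
    [SigmaFinite ν] {D : Set (Lp ℂ ∞ ν)} (hD : IsDeterminingSet D)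
    {M : ClosedSubmodule ℂ (Lp H 2 ν)} (hinv : IsMultInvariant D M)
    (hfg : IsMultFinitelyGenerated D M)
    {J : Ω → ClosedSubmodule ℂ H} (hJ : IsRangeFunctionOf J M) :
    multLength D M = essSup (fun ω => closedDim (J ω)) ν := by
  apply le_antisymm
  · obtain ⟨S, hS, hMS⟩ := hfg
    -- The given generators are not assumed to lie in `M`, only their `D`-multiples do, and `D` need
    -- not contain `1`.
    have hSM : ∀ Φ ∈ S, Φ ∈ M := fun Φ hΦ => hJ.mem_of_smul_mem hD fun g hg => by
      rw [hMS]; exact smul_mem_multGenerated hΦ hg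
    have hfin : Finite S := hS
    have h1 := hJ.ae_le_span (F := ((↑) : S → Lp H 2 ν)) (by rwa [Subtype.range_coe])
    -- Adjoining the zero function provides a filler index even when `S` is empty.
    let F : Option S → Lp H 2 ν := fun o => o.elim 0 (↑)
    have hspan : ∀ᵐ ω ∂ν, (J ω).toSubmodule ≤ Submodule.span ℂ (Set.range fun i => F i ω) := by
      filter_upwards [h1] with ω hω
      refine hω.trans (Submodule.span_mono ?_)
      rintro _ ⟨i, rfl⟩
      exact ⟨some i, rfl⟩
    have hF : ∀ i, F i ∈ M := by
      rintro (_ | i)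
      · exact M.zero_mem
      · exact hSM _ i.2
    have hle : ∀ᵐ ω ∂ν, closedDim (J ω) ≤ essSup (fun ω => closedDim (J ω)) ν := ae_le_essSup
    generalize hs : essSup (fun ω => closedDim (J ω)) ν = k at hle
    induction k using ENat.recTopCoe with
    | top => exact le_top
    | coe n =>
      obtain ⟨Φ, hΦ, hΦs⟩ := hJ.exists_fin_span none hF hspan hle
      exact sInf_le ⟨n, rfl, Φ, hΦ, hJ.eq_multGenerated hD hinv hΦ hΦs⟩
  · refine le_sInf ?_
    rintro _ ⟨n, rfl, Φ, -, hM⟩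
    refine essSup_le_of_ae_le _ ?_
    filter_upwards [hJ.ae_le_span hM] with ω hω
    exact closedDim_le_of_le_span hω

end MeasurableSelection

/-! ### Fourier analysis on the dual group -/

section DualGroup

open Filter Topology

variable {Γ : Type*} [AddCommGroup Γ] [TopologicalSpace Γ]

theorem pairing_add (γ γ' : Γ) (α : DualGroup Γ) :
    pairing (γ + γ') α = pairing γ α * pairing γ' α := by
  simp [pairing, ofAdd_add, map_mul]

theorem pairing_zero (α : DualGroup Γ) : pairing (0 : Γ) α = 1 := by
  simp [pairing, ofAdd_zero, map_one]

theorem pairing_neg (γ : Γ) (α : DualGroup Γ) : pairing (-γ) α = star (pairing γ α) := by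
  simp only [pairing, ofAdd_neg, map_inv]
  exact Circle.coe_inv_eq_conj _

theorem norm_pairing (γ : Γ) (α : DualGroup Γ) : ‖pairing γ α‖ = 1 := Circle.norm_coe _

theorem pairing_mul (γ : Γ) (α β : DualGroup Γ) :
    pairing γ (α * β) = pairing γ α * pairing γ β := rfl

/-- Homomorphisms into `ℚ/ℤ` separate the points of any abelian group. Composing with the injections
`ℚ/ℤ → ℝ/ℤ → Circle` gives a character, continuous since `Γ` is discrete. -/
theorem exists_pairing_ne_one [DiscreteTopology Γ] {γ : Γ} (hγ : γ ≠ 0) :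
    ∃ β : DualGroup Γ, pairing γ β ≠ 1 := by
  obtain ⟨c, hc⟩ := CharacterModule.exists_character_apply_ne_zero_of_ne_zero hγ
  let j : AddCircle (1 : ℚ) →+ AddCircle (1 : ℝ) :=
    QuotientAddGroup.map _ _ (Rat.castHom ℝ).toAddMonoidHom (by
      rw [AddSubgroup.zmultiples_le]
      exact ⟨1, by simp⟩)
  have hj : ∀ x, j x = 0 → x = 0 := by
    intro x hx
    induction x using QuotientAddGroup.induction_on with
    | H q =>
      have h1 : ((q : ℝ) : AddCircle (1 : ℝ)) = 0 := hx
      obtain ⟨n, hn⟩ := (AddCircle.coe_eq_zero_iff (1 : ℝ)).1 h1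
      refine (AddCircle.coe_eq_zero_iff (1 : ℚ)).2 ⟨n, ?_⟩
      simp only [zsmul_eq_mul, mul_one] at hn ⊢
      exact_mod_cast hn
  let f : Multiplicative Γ →* Circle :=
    { toFun := fun x => AddCircle.toCircle (j (c x.toAdd))
      map_one' := by simp
      map_mul' := fun x y => by simp [AddCircle.toCircle_add] }
  let β : Multiplicative Γ →ₜ* Circle := ⟨f, continuous_of_discreteTopology⟩
  refine ⟨(β : DualGroup Γ), fun h => hc (hj _ ?_)⟩
  have h1 : AddCircle.toCircle (j (c γ)) = 1 := Circle.coe_injective h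
  exact AddCircle.injective_toCircle one_ne_zero (h1.trans AddCircle.toCircle_zero.symm)

instance [DiscreteTopology Γ] : (dualHaar Γ).IsMulLeftInvariant := by
  unfold dualHaar; infer_instance

/-- Translation by some `β` with `pairing γ β ≠ 1` preserves the integral and also multiplies it by
`pairing γ β`. -/
theorem integral_pairing [DiscreteTopology Γ] {γ : Γ} (hγ : γ ≠ 0) :
    ∫ α, pairing γ α ∂(dualHaar Γ) = 0 := by
  obtain ⟨β, hβ⟩ := exists_pairing_ne_one hγ
  have h := integral_mul_left_eq_self (μ := dualHaar Γ) (fun α => pairing γ α) β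
  simp_rw [pairing_mul] at h
  rw [integral_const_mul] at h
  have h1 : (pairing γ β - 1) * ∫ α, pairing γ α ∂(dualHaar Γ) = 0 := by
    rw [sub_mul, h, one_mul, sub_self]
  exact (mul_eq_zero.1 h1).resolve_left (sub_ne_zero.2 hβ)

/-- Evaluation at all `γ` embeds the compact dual into a countable product of copies of `ℂ`. -/
theorem metrizableSpace_dualGroup [DiscreteTopology Γ] [Countable Γ] :
    TopologicalSpace.MetrizableSpace (DualGroup Γ) := by
  have hcont : Continuous fun (α : DualGroup Γ) (γ : Γ) => pairing γ α :=
    continuous_pi fun γ => continuous_pairing γ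
  have hinj : Function.Injective fun (α : DualGroup Γ) (γ : Γ) => pairing γ α := by
    intro α β h
    refine PontryaginDual.ext fun a => ?_
    exact Circle.coe_injective (congrFun h a.toAdd)
  have hemb := (hcont.isClosedEmbedding hinj).isEmbedding
  have := hemb.secondCountableTopology
  exact TopologicalSpace.metrizableSpace_of_t3_secondCountable _

/-- The span of the characters as a star subalgebra. -/
def pairingSubalgebra (Γ : Type*) [AddCommGroup Γ] [TopologicalSpace Γ] [DiscreteTopology Γ] :
    StarSubalgebra ℂ C(DualGroup Γ, ℂ) where
  toSubalgebra := Algebra.adjoin ℂ (Set.range fun γ => ⟨pairing γ, continuous_pairing γ⟩)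
  star_mem' := by
    change Algebra.adjoin ℂ (Set.range fun γ => _) ≤ star (Algebra.adjoin ℂ (Set.range fun γ => _))
    refine Algebra.adjoin_le ?_
    rintro - ⟨γ, rfl⟩
    refine Algebra.subset_adjoin ⟨-γ, ?_⟩
    ext α
    exact pairing_neg γ α

theorem pairingSubalgebra_coe [DiscreteTopology Γ] :
    Subalgebra.toSubmodule (pairingSubalgebra Γ).toSubalgebra =
      Submodule.span ℂ (Set.range fun γ : Γ =>
        (⟨pairing γ, continuous_pairing γ⟩ : C(DualGroup Γ, ℂ))) := by
  apply Algebra.adjoin_eq_span_of_subset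
  refine Set.Subset.trans ?_ Submodule.subset_span
  intro x hx
  refine Submonoid.closure_induction (fun _ => id) ⟨0, ?_⟩ ?_ hx
  · ext α; exact pairing_zero α
  · rintro - - - - ⟨m, rfl⟩ ⟨n, rfl⟩
    refine ⟨m + n, ?_⟩
    ext α
    exact pairing_add m n α

/-- Stone–Weierstrass: the span is a star subalgebra, and it separates points because an element of
the dual is determined by its values. -/
theorem span_pairing_closure_eq_top [DiscreteTopology Γ] :
    (Submodule.span ℂ (Set.range fun γ : Γ =>
      (⟨pairing γ, continuous_pairing γ⟩ : C(DualGroup Γ, ℂ)))).topologicalClosure = ⊤ := by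
  rw [← pairingSubalgebra_coe]
  refine congr_arg (fun A : StarSubalgebra ℂ C(DualGroup Γ, ℂ) =>
    Subalgebra.toSubmodule A.toSubalgebra)
    (ContinuousMap.starSubalgebra_topologicalClosure_eq_top_of_separatesPoints
      (pairingSubalgebra Γ) ?_)
  intro α β hαβ
  by_contra! hcon
  refine hαβ (PontryaginDual.ext fun a => Circle.coe_injective ?_)
  exact hcon _ ⟨_, Algebra.subset_adjoin ⟨a.toAdd, rfl⟩, rfl⟩

/-- Uniqueness of Fourier coefficients on the dual group. -/
theorem ae_eq_zero_of_integral_mul_pairing [DiscreteTopology Γ] [Countable Γ]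
    {f : DualGroup Γ → ℂ} (hf : Integrable f (dualHaar Γ))
    (h : ∀ γ : Γ, ∫ α, f α * pairing γ α ∂(dualHaar Γ) = 0) : f =ᵐ[dualHaar Γ] 0 := by
  have hint : ∀ φ : C(DualGroup Γ, ℂ), Integrable (fun α => f α * φ α) (dualHaar Γ) := fun φ =>
    hf.mul_bdd (c := ‖φ‖) φ.continuous.aestronglyMeasurable (.of_forall fun α => φ.norm_coe_le_norm α)
  -- Integration against `f` is a bounded functional that kills the dense span of the characters,
  -- hence all continuous functions.
  let L : C(DualGroup Γ, ℂ) →L[ℂ] ℂ := LinearMap.mkContinuous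
    { toFun := fun φ => ∫ α, f α * φ α ∂(dualHaar Γ)
      map_add' := fun φ ψ => by
        rw [← integral_add (hint φ) (hint ψ)]
        simp [mul_add]
      map_smul' := fun c φ => by
        simp only [ContinuousMap.coe_smul, Pi.smul_apply, smul_eq_mul, RingHom.id_apply]
        rw [← integral_const_mul]
        congr 1; ext α; ring }
    (∫ α, ‖f α‖ ∂(dualHaar Γ)) fun φ => by
      rw [← integral_mul_const]
      refine norm_integral_le_of_norm_le (hf.norm.mul_const _) (.of_forall fun α => ?_)
      rw [norm_mul]
      exact mul_le_mul_of_nonneg_left (φ.norm_coe_le_norm α) (norm_nonneg _)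
  have hL : ∀ φ, L φ = 0 := by
    have hle : (Submodule.span ℂ (Set.range fun γ : Γ =>
        (⟨pairing γ, continuous_pairing γ⟩ : C(DualGroup Γ, ℂ)))).topologicalClosure ≤
        LinearMap.ker (L : C(DualGroup Γ, ℂ) →ₗ[ℂ] ℂ) := by
      refine Submodule.topologicalClosure_minimal _ (Submodule.span_le.2 ?_) L.isClosed_ker
      rintro _ ⟨γ, rfl⟩
      exact h γ
    rw [span_pairing_closure_eq_top] at hle
    exact fun φ => hle Submodule.mem_top
  have := metrizableSpace_dualGroup (Γ := Γ)
  let _ := TopologicalSpace.metrizableSpaceMetric (DualGroup Γ)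
  refine ae_eq_zero_of_forall_setIntegral_isClosed_eq_zero hf fun F hF => ?_
  -- Continuous functions bounded by `1` converge pointwise to the indicator of `F`, so dominated
  -- convergence makes the integral of `f` over `F` zero.
  let φ : ℕ → C(DualGroup Γ, ℂ) := fun n =>
    ⟨fun α => ((hF.apprSeq n α : ℝ) : ℂ), by fun_prop⟩
  have hlim : Tendsto (fun n => ∫ α, f α * φ n α ∂(dualHaar Γ)) atTop
      (𝓝 (∫ α, F.indicator f α ∂(dualHaar Γ))) := by
    refine tendsto_integral_of_dominated_convergence (fun α => ‖f α‖)
      (fun n => (hint (φ n)).aestronglyMeasurable) hf.norm (fun n => .of_forall fun α => ?_)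
      (.of_forall fun α => ?_)
    · rw [norm_mul]
      refine mul_le_of_le_one_right (norm_nonneg _) ?_
      have := HasOuterApproxClosed.apprSeq_apply_le_one hF n α
      simpa [φ] using this
    · have h1 := tendsto_pi_nhds.1 (HasOuterApproxClosed.tendsto_apprSeq hF) α
      have h2 : Tendsto (fun n => f α * (((hF.apprSeq n α : NNReal) : ℝ) : ℂ)) atTop
          (𝓝 (f α * (((F.indicator (fun _ => (1 : NNReal)) α : NNReal) : ℝ) : ℂ))) :=
        ((Complex.continuous_ofReal.comp NNReal.continuous_coe).tendsto _ |>.comp h1).const_mul _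
      have h3 : F.indicator f α =
          f α * (((F.indicator (fun _ => (1 : NNReal)) α : NNReal) : ℝ) : ℂ) := by
        by_cases hα : α ∈ F <;> simp [hα]
      rw [h3]
      exact h2
  rw [← integral_indicator hF.measurableSet]
  refine tendsto_nhds_unique hlim ?_
  have hz : (fun n => ∫ α, f α * φ n α ∂(dualHaar Γ)) = fun _ => 0 := funext fun n => hL (φ n)
  rw [hz]
  exact tendsto_const_nhds

/-! ### Characters as multipliers and as an orthogonal system in `L²(Γ̂, E)` -/

variable [DiscreteTopology Γ]

theorem memLp_top_pairing (γ : Γ) : MemLp (pairing γ : DualGroup Γ → ℂ) ∞ (dualHaar Γ) :=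
  memLp_top_of_bound (continuous_pairing γ).aestronglyMeasurable 1
    (.of_forall fun α => (norm_pairing γ α).le)

/-- The character of the dual group given by `γ`, as an element of `L^∞`. -/
def pairingLp (γ : Γ) : Lp ℂ ∞ (dualHaar Γ) := (memLp_top_pairing γ).toLp _

theorem coeFn_pairingLp (γ : Γ) : pairingLp γ =ᵐ[dualHaar Γ] pairing γ :=
  (memLp_top_pairing γ).coeFn_toLp

variable (Γ) in
theorem isDeterminingSet_range_pairingLp [Countable Γ] :
    IsDeterminingSet (Set.range (pairingLp (Γ := Γ))) := by
  intro f hf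
  rw [Lp.eq_zero_iff_ae_eq_zero]
  refine ae_eq_zero_of_integral_mul_pairing (L1.integrable_coeFn f) fun γ => ?_
  rw [← hf _ ⟨γ, rfl⟩]
  refine integral_congr_ae ?_
  filter_upwards [coeFn_pairingLp γ] with α hα
  rw [hα]

variable {E : Type*} [NormedAddCommGroup E]

theorem coeFn_pairingSMul [NormedSpace ℂ E] (γ : Γ) (u : E) :
    pairingSMul γ u =ᵐ[dualHaar Γ] fun α => pairing γ α • u :=
  (memLp_pairing_smul γ u).coeFn_toLp

theorem pairingLp_smul_pairingSMul [NormedSpace ℂ E] (γ γ' : Γ) (u : E) :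
    (pairingLp γ • pairingSMul γ' u : Lp E 2 (dualHaar Γ)) = pairingSMul (γ + γ') u := by
  apply Lp.ext
  filter_upwards [Lp.coeFn_lpSMul (r := 2) (pairingLp γ) (pairingSMul γ' u),
    coeFn_pairingLp γ, coeFn_pairingSMul γ' u, coeFn_pairingSMul (γ + γ') u] with α h1 h2 h3 h4
  rw [h1, h4, Pi.smul_apply', h2, h3, pairing_add, mul_smul]

theorem norm_pairingSMul [NormedSpace ℂ E] (γ : Γ) (u : E) : ‖pairingSMul γ u‖ = ‖u‖ := by
  rw [pairingSMul, Lp.norm_toLp]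
  have h : eLpNorm (fun α : DualGroup Γ => pairing γ α • u) 2 (dualHaar Γ) =
      eLpNorm (fun _ : DualGroup Γ => u) 2 (dualHaar Γ) := by
    refine eLpNorm_congr_norm_ae (.of_forall fun α => ?_)
    rw [norm_smul, norm_pairing, one_mul]
  rw [h, eLpNorm_const _ (by norm_num) (IsProbabilityMeasure.ne_zero _)]
  simp

/-- `u ↦ (γ, ·) u` as an isometry from `E` to `L²(Γ̂, E)`. -/
def pairingSMulₗᵢ (E : Type*) [NormedAddCommGroup E] [NormedSpace ℂ E] (γ : Γ) :
    E →ₗᵢ[ℂ] Lp E 2 (dualHaar Γ) where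
  toFun := pairingSMul γ
  map_add' u v := by
    rw [pairingSMul, pairingSMul, pairingSMul, ← MemLp.toLp_add]
    congr 1
    ext α; simp
  map_smul' c u := by
    rw [pairingSMul, pairingSMul, RingHom.id_apply, ← MemLp.toLp_const_smul]
    congr 1
    ext α; exact smul_comm _ _ _
  norm_map' := norm_pairingSMul γ

theorem orthogonalFamily_pairingSMul [InnerProductSpace ℂ E] [CompleteSpace E] :
    OrthogonalFamily ℂ (fun _ : Γ => E) fun γ => pairingSMulₗᵢ E (-γ) := by
  intro γ γ' hne u v
  change inner ℂ (pairingSMul (-γ) u) (pairingSMul (-γ') v) = 0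
  rw [L2.inner_def]
  have h : (fun α => inner ℂ (pairingSMul (-γ) u α) (pairingSMul (-γ') v α)) =ᵐ[dualHaar Γ]
      fun α => pairing (γ - γ') α * inner ℂ u v := by
    filter_upwards [coeFn_pairingSMul (-γ) u, coeFn_pairingSMul (-γ') v] with α h1 h2
    rw [h1, h2, inner_smul_left, inner_smul_right, sub_eq_add_neg, pairing_add, ← mul_assoc,
      pairing_neg γ, starRingEnd_apply, star_star]
  rw [integral_congr_ae h, integral_mul_const, integral_pairing (sub_ne_zero.2 hne), zero_mul]

/-- Products of characters and constant vectors are total in `L²(Γ̂, E)`. -/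
theorem eq_zero_of_inner_pairingSMul [Countable Γ] [InnerProductSpace ℂ E]
    [TopologicalSpace.SeparableSpace E] {Φ : Lp E 2 (dualHaar Γ)}
    (h : ∀ (γ : Γ) (u : E), inner ℂ (pairingSMul γ u) Φ = 0) : Φ = 0 := by
  have : SecondCountableTopology E := UniformSpace.secondCountable_of_separable E
  rw [Lp.eq_zero_iff_ae_eq_zero]
  -- Testing against a fixed `u` leaves a scalar function whose Fourier coefficients are the inner
  -- products in `h`.
  refine ae_eq_zero_of_forall_inner (𝕜 := ℂ) fun u => ?_
  refine ae_eq_zero_of_integral_mul_pairing ?_ fun γ => ?_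
  · refine (L2.integrable_inner (𝕜 := ℂ) (pairingSMul (0 : Γ) u) Φ).congr ?_
    filter_upwards [coeFn_pairingSMul (0 : Γ) u] with α hα
    rw [hα, pairing_zero, one_smul]
  · rw [← h (-γ) u, L2.inner_def]
    refine integral_congr_ae ?_
    filter_upwards [coeFn_pairingSMul (-γ) u] with α hα
    rw [hα, inner_smul_left, pairing_neg, starRingEnd_apply, star_star, mul_comm]

end DualGroup

/-! ### The representation, the unitarity of the Zak transform, and part (B) -/

section ZakTransform

namespace QuasiInvariantAction

variable {Γ : Type*} [AddCommGroup Γ] {X : Type*} [MeasurableSpace X] {μ : Measure X}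

theorem coeFn_rep (σ : QuasiInvariantAction Γ μ) (γ : Γ) (ψ : Lp ℂ 2 μ) :
    σ.rep γ ψ =ᵐ[μ] fun x => (Real.sqrt (σ.jac (-γ) x) : ℂ) * ψ (σ.act (-γ) x) :=
  (σ.memLp_rep γ ψ).coeFn_toLp

theorem ae_act (σ : QuasiInvariantAction Γ μ) (γ : Γ) {p : X → Prop} (h : ∀ᵐ x ∂μ, p x) :
    ∀ᵐ x ∂μ, p (σ.act (-γ) x) :=
  (σ.quasiMeasurePreserving_act γ).ae h

theorem rep_add_vec (σ : QuasiInvariantAction Γ μ) (γ : Γ) (ψ ψ' : Lp ℂ 2 μ) :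
    σ.rep γ (ψ + ψ') = σ.rep γ ψ + σ.rep γ ψ' := by
  apply Lp.ext
  filter_upwards [σ.coeFn_rep γ (ψ + ψ'), σ.coeFn_rep γ ψ, σ.coeFn_rep γ ψ',
    Lp.coeFn_add (σ.rep γ ψ) (σ.rep γ ψ'), σ.ae_act γ (Lp.coeFn_add ψ ψ')] with x h1 h2 h3 h4 h5
  rw [h1, h4, Pi.add_apply, h2, h3, h5, Pi.add_apply, mul_add]

theorem rep_smul (σ : QuasiInvariantAction Γ μ) (γ : Γ) (c : ℂ) (ψ : Lp ℂ 2 μ) :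
    σ.rep γ (c • ψ) = c • σ.rep γ ψ := by
  apply Lp.ext
  filter_upwards [σ.coeFn_rep γ (c • ψ), σ.coeFn_rep γ ψ,
    Lp.coeFn_smul c (σ.rep γ ψ), σ.ae_act γ (Lp.coeFn_smul c ψ)] with x h1 h2 h3 h4
  rw [h1, h3, Pi.smul_apply, h2, h4, Pi.smul_apply, smul_eq_mul, smul_eq_mul]
  ring

theorem jac_zero [SigmaFinite μ] (σ : QuasiInvariantAction Γ μ) : ∀ᵐ x ∂μ, σ.jac 0 x = 1 := by
  have h1 : μ.withDensity (fun x => ENNReal.ofReal (σ.jac 0 x)) = μ.withDensity 1 := by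
    rw [← σ.map_act, withDensity_one, neg_zero]
    have : σ.act 0 = id := funext σ.act_zero
    rw [this, Measure.map_id]
  have h2 := (withDensity_eq_iff_of_sigmaFinite
    (σ.measurable_jac 0).ennreal_ofReal.aemeasurable aemeasurable_const).1 h1
  filter_upwards [h2] with x hx
  exact ENNReal.ofReal_eq_one.1 hx

theorem measurableSet_image_act (σ : QuasiInvariantAction Γ μ) (γ : Γ) {E : Set X}
    (hE : MeasurableSet E) : MeasurableSet (σ.act γ '' E) := by
  rw [← σ.preimage_act]; exact σ.measurable_act _ hE

/-- Change of variables for the action. -/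
theorem setLIntegral_image_act (σ : QuasiInvariantAction Γ μ) (γ : Γ) {E : Set X}
    (hE : MeasurableSet E) {f : X → ℝ≥0∞} (hf : Measurable f) :
    ∫⁻ x in σ.act γ '' E, f x ∂μ = ∫⁻ x in E, ENNReal.ofReal (σ.jac γ x) * f (σ.act γ x) ∂μ := by
  have hpre : σ.act γ ⁻¹' (σ.act γ '' E) = E := by
    rw [← σ.preimage_act, ← Set.preimage_comp]
    have : σ.act (-γ) ∘ σ.act γ = id := by
      funext x; simp [σ.act_act, σ.act_zero]
    rw [this, Set.preimage_id]
  have hmap := σ.map_withDensity (-γ)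
  rw [neg_neg] at hmap
  have h1 : ∀ S : Set X, ∫⁻ x in S, f x ∂μ = ∫⁻ x in S, f x
      ∂((μ.withDensity fun x => ENNReal.ofReal (σ.jac γ x)).map (σ.act γ)) := by
    intro S; rw [hmap]
  rw [h1, setLIntegral_map (σ.measurableSet_image_act γ hE) hf (σ.measurable_act γ), hpre]
  exact setLIntegral_withDensity_eq_setLIntegral_mul _ (σ.measurable_jac γ).ennreal_ofReal
    (hf.comp (σ.measurable_act γ)) hE

/-- The cocycle identity for the Jacobian. -/
theorem jac_add [SigmaFinite μ] (σ : QuasiInvariantAction Γ μ) (γ γ' : Γ) :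
    ∀ᵐ x ∂μ, σ.jac (γ + γ') x = σ.jac γ' x * σ.jac γ (σ.act γ' x) := by
  -- Both densities give `E` the `μ`-measure of its image under `σ_{γ+γ'}`, and densities for a
  -- σ-finite measure are unique almost everywhere.
  have h1 : μ.withDensity (fun x => ENNReal.ofReal (σ.jac (γ + γ') x)) =
      μ.withDensity ((fun x => ENNReal.ofReal (σ.jac γ' x)) *
        fun x => ENNReal.ofReal (σ.jac γ (σ.act γ' x))) := by
    ext E hE
    have himage : σ.act (γ + γ') '' E = σ.act γ '' (σ.act γ' '' E) := by
      rw [Set.image_image]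
      simp_rw [σ.act_act]
    rw [withDensity_apply _ hE, withDensity_apply _ hE, ← σ.measure_image _ E hE, himage,
      σ.measure_image γ _ (σ.measurableSet_image_act γ' hE),
      σ.setLIntegral_image_act γ' hE (σ.measurable_jac γ).ennreal_ofReal]
    rfl
  have h2 := (withDensity_eq_iff_of_sigmaFinite
    (σ.measurable_jac _).ennreal_ofReal.aemeasurable
    ((σ.measurable_jac γ').ennreal_ofReal.mul
      ((σ.measurable_jac γ).ennreal_ofReal.comp (σ.measurable_act γ'))).aemeasurable).1 h1
  filter_upwards [h2] with x hx
  rw [Pi.mul_apply, Function.comp_apply, ← ENNReal.ofReal_mul (σ.jac_pos _ _).le] at hx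
  exact (ENNReal.ofReal_eq_ofReal_iff (σ.jac_pos _ _).le
    (mul_pos (σ.jac_pos _ _) (σ.jac_pos _ _)).le).1 hx

theorem rep_zero [SigmaFinite μ] (σ : QuasiInvariantAction Γ μ) (ψ : Lp ℂ 2 μ) :
    σ.rep 0 ψ = ψ := by
  apply Lp.ext
  filter_upwards [σ.coeFn_rep 0 ψ, σ.jac_zero] with x h1 h2
  rw [h1, neg_zero, h2, σ.act_zero, Real.sqrt_one, Complex.ofReal_one, one_mul]

theorem rep_rep [SigmaFinite μ] (σ : QuasiInvariantAction Γ μ) (γ γ' : Γ) (ψ : Lp ℂ 2 μ) :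
    σ.rep γ (σ.rep γ' ψ) = σ.rep (γ + γ') ψ := by
  apply Lp.ext
  filter_upwards [σ.coeFn_rep γ (σ.rep γ' ψ), σ.ae_act γ (σ.coeFn_rep γ' ψ),
    σ.coeFn_rep (γ + γ') ψ, σ.jac_add (-γ') (-γ)] with x h1 h2 h3 h4
  rw [h1, h2, h3, σ.act_act, show -(γ + γ') = -γ' + -γ by abel, h4,
    Real.sqrt_mul (σ.jac_pos _ _).le, Complex.ofReal_mul, mul_assoc]

/-- The restriction to `C` of `Π_σ(γ)ψ`. -/
def repRestrict (σ : QuasiInvariantAction Γ μ) (C : Set X) (γ : Γ) (ψ : Lp ℂ 2 μ) :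
    Lp ℂ 2 (μ.restrict C) :=
  LpToLpRestrictCLM X ℂ ℂ μ 2 C (σ.rep γ ψ)

theorem coeFn_repRestrict (σ : QuasiInvariantAction Γ μ) (C : Set X) (γ : Γ) (ψ : Lp ℂ 2 μ) :
    σ.repRestrict C γ ψ =ᵐ[μ.restrict C] σ.rep γ ψ :=
  LpToLpRestrictCLM_coeFn ℂ C (σ.rep γ ψ)

theorem _root_.ofReal_norm_sq_eq_lintegral {Y E : Type*} [MeasurableSpace Y] {m : Measure Y}
    [NormedAddCommGroup E] (f : Lp E 2 m) :
    ENNReal.ofReal (‖f‖ ^ 2) = ∫⁻ x, ‖f x‖ₑ ^ 2 ∂m := by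
  rw [ENNReal.ofReal_pow (norm_nonneg _), Lp.norm_def, ENNReal.ofReal_toReal (Lp.eLpNorm_ne_top f),
    eLpNorm_eq_lintegral_rpow_enorm_toReal (by norm_num) (by norm_num)]
  simp only [ENNReal.toReal_ofNat, ENNReal.rpow_ofNat]
  rw [← ENNReal.rpow_natCast, ← ENNReal.rpow_mul]
  norm_num

theorem norm_sq_repRestrict (σ : QuasiInvariantAction Γ μ) {C : Set X} (hC : MeasurableSet C)
    (γ : Γ) (ψ : Lp ℂ 2 μ) :
    ENNReal.ofReal (‖σ.repRestrict C γ ψ‖ ^ 2) = ∫⁻ x in σ.act (-γ) '' C, ‖ψ x‖ₑ ^ 2 ∂μ := by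
  have hm : Measurable fun x => ‖ψ x‖ₑ ^ 2 := (Lp.stronglyMeasurable ψ).measurable.enorm.pow_const 2
  rw [ofReal_norm_sq_eq_lintegral, σ.setLIntegral_image_act (-γ) hC hm]
  refine lintegral_congr_ae ?_
  filter_upwards [σ.coeFn_repRestrict C γ ψ, ae_restrict_of_ae (σ.coeFn_rep γ ψ)] with x h1 h2
  rw [h1, h2]
  simp only [enorm_mul, mul_pow]
  congr 1
  rw [← ofReal_norm, ← ENNReal.ofReal_pow (norm_nonneg _), Complex.norm_real,
    Real.norm_eq_abs, sq_abs, Real.sq_sqrt (σ.jac_pos _ _).le]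

/-- By change of variables each term is the mass of `|ψ|²` on the translate `σ_{-γ}(C)`, and these
translates tile `X`. -/
theorem hasSum_norm_sq_repRestrict [Countable Γ] (σ : QuasiInvariantAction Γ μ) {C : Set X}
    (hC : σ.IsTilingSet C) (ψ : Lp ℂ 2 μ) :
    HasSum (fun γ => ‖σ.repRestrict C γ ψ‖ ^ 2) (‖ψ‖ ^ 2) := by
  have hmeas : ∀ γ, MeasurableSet (σ.act γ '' C) := fun γ =>
    σ.measurableSet_image_act γ hC.measurableSet
  have h : ∑' γ, ENNReal.ofReal (‖σ.repRestrict C γ ψ‖ ^ 2) = ENNReal.ofReal (‖ψ‖ ^ 2) := by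
    simp_rw [σ.norm_sq_repRestrict hC.measurableSet]
    have hneg := (Equiv.neg Γ).tsum_eq fun γ => ∫⁻ x in σ.act γ '' C, ‖ψ x‖ₑ ^ 2 ∂μ
    simp only [Equiv.neg_apply] at hneg
    rw [hneg, ← lintegral_iUnion₀ (fun γ => (hmeas γ).nullMeasurableSet)
        (fun γ γ' hne => hC.disjoint γ γ' hne),
      setLIntegral_congr (ae_eq_univ.2 hC.cover), Measure.restrict_univ,
      ofReal_norm_sq_eq_lintegral]
  have hne : ∑' γ, ENNReal.ofReal (‖σ.repRestrict C γ ψ‖ ^ 2) ≠ ∞ := by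
    rw [h]; exact ENNReal.ofReal_ne_top
  have h1 := (ENNReal.hasSum_toReal hne)
  rw [← ENNReal.tsum_toReal_eq (fun γ => ENNReal.ofReal_ne_top), h] at h1
  simpa [ENNReal.toReal_ofReal, sq_nonneg] using h1

variable [TopologicalSpace Γ] [DiscreteTopology Γ] [Countable Γ]

theorem hasSum_zak (σ : QuasiInvariantAction Γ μ) {C : Set X} (hC : σ.IsTilingSet C)
    (ψ : Lp ℂ 2 μ) :
    HasSum (fun γ => pairingSMul (-γ) (σ.repRestrict C γ ψ)) (σ.zak C ψ) :=
  ((orthogonalFamily_pairingSMul.summable_iff_norm_sq_summable fun γ =>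
    σ.repRestrict C γ ψ).2 (σ.hasSum_norm_sq_repRestrict hC ψ).summable).hasSum

/-- Pythagoras for the partial sums, whose terms belong to distinct characters, followed by passage
to the limit. -/
theorem norm_zak (σ : QuasiInvariantAction Γ μ) {C : Set X} (hC : σ.IsTilingSet C)
    (ψ : Lp ℂ 2 μ) : ‖σ.zak C ψ‖ = ‖ψ‖ := by
  have h1 := ((σ.hasSum_zak hC ψ).norm.pow 2)
  have h2 := σ.hasSum_norm_sq_repRestrict hC ψ
  have h3 : ∀ s : Finset Γ, ‖∑ γ ∈ s, pairingSMul (-γ) (σ.repRestrict C γ ψ)‖ ^ 2 =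
      ∑ γ ∈ s, ‖σ.repRestrict C γ ψ‖ ^ 2 := fun s =>
    orthogonalFamily_pairingSMul.norm_sum (fun γ => σ.repRestrict C γ ψ) s
  simp_rw [h3] at h1
  exact (sq_eq_sq₀ (norm_nonneg _) (norm_nonneg _)).1 (tendsto_nhds_unique h1 h2)

/-- The Zak transform as a linear isometry. -/
def zakₗᵢ (σ : QuasiInvariantAction Γ μ) {C : Set X} (hC : σ.IsTilingSet C) :
    Lp ℂ 2 μ →ₗᵢ[ℂ] Lp (Lp ℂ 2 (μ.restrict C)) 2 (dualHaar Γ) where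
  toFun := σ.zak C
  map_add' ψ ψ' := by
    refine (σ.hasSum_zak hC (ψ + ψ')).unique ?_
    convert (σ.hasSum_zak hC ψ).add (σ.hasSum_zak hC ψ') using 2 with γ
    rw [repRestrict, rep_add_vec, map_add]
    exact (pairingSMulₗᵢ _ (-γ)).map_add _ _
  map_smul' c ψ := by
    refine (σ.hasSum_zak hC (c • ψ)).unique ?_
    rw [RingHom.id_apply]
    convert (σ.hasSum_zak hC ψ).const_smul c using 2 with γ
    rw [repRestrict, rep_smul, map_smul]
    exact (pairingSMulₗᵢ _ (-γ)).map_smul _ _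
  norm_map' := σ.norm_zak hC

/-- The Zak transform intertwines the representation with multiplication by characters. -/
theorem zak_rep [SigmaFinite μ] (σ : QuasiInvariantAction Γ μ) {C : Set X}
    (hC : σ.IsTilingSet C) (γ : Γ) (ψ : Lp ℂ 2 μ) :
    σ.zak C (σ.rep γ ψ) = pairingLp γ • σ.zak C ψ := by
  let T : Lp (Lp ℂ 2 (μ.restrict C)) 2 (dualHaar Γ) →+
      Lp (Lp ℂ 2 (μ.restrict C)) 2 (dualHaar Γ) :=
    AddMonoidHom.mk' (fun Φ => pairingLp γ • Φ) fun Φ Ψ => Lp.add_smul _ _ _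
  have hT : Continuous T :=
    AddMonoidHomClass.continuous_of_bound T ‖pairingLp γ‖ fun Φ => Lp.norm_smul_le _ _
  have h1 := (σ.hasSum_zak hC ψ).map T hT
  -- Multiplying by the character `γ` shifts frequencies by `γ`; reindexing `γ' ↦ γ' + γ` restores
  -- the frequency `-γ'` and leaves the coefficient of `Π_σ(γ)ψ`.
  have h2 := (Equiv.addRight γ).hasSum_iff.2 h1
  refine (σ.hasSum_zak hC (σ.rep γ ψ)).unique ?_
  change HasSum _ (T (σ.zak C ψ))
  convert h2 using 2 with γ'
  simp only [T, Function.comp_apply, Equiv.coe_addRight, AddMonoidHom.mk'_apply]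
  rw [pairingLp_smul_pairingSMul, repRestrict, rep_rep, repRestrict]
  congr 1
  abel

/-- The preimage is `u` extended by zero outside `C`. Its coefficient at `0` already carries the
whole norm, so the identity for the squared norms forces all others to vanish. -/
theorem pairingSMul_zero_mem_range_zak [SigmaFinite μ] (σ : QuasiInvariantAction Γ μ) {C : Set X}
    (hC : σ.IsTilingSet C) (u : Lp ℂ 2 (μ.restrict C)) :
    ∃ ψ, σ.zak C ψ = pairingSMul (0 : Γ) u := by
  have hL : MemLp (C.indicator u) 2 μ :=
    (memLp_indicator_iff_restrict hC.measurableSet).2 (Lp.memLp u)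
  set ψ := hL.toLp _ with hψ
  have h0 : σ.repRestrict C 0 ψ = u := by
    apply Lp.ext
    filter_upwards [σ.coeFn_repRestrict C 0 ψ, ae_restrict_of_ae hL.coeFn_toLp,
      ae_restrict_mem hC.measurableSet] with x h1 h2 h3
    rw [h1, rep_zero, hψ, h2, Set.indicator_of_mem h3]
  have hnorm : ‖ψ‖ = ‖u‖ := by
    rw [hψ, Lp.norm_toLp, eLpNorm_indicator_eq_eLpNorm_restrict hC.measurableSet, Lp.norm_def]
  have hne : ∀ γ, γ ≠ 0 → σ.repRestrict C γ ψ = 0 := by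
    classical
    intro γ hγ
    have h1 := sum_le_hasSum {0, γ} (fun _ _ => sq_nonneg _) (σ.hasSum_norm_sq_repRestrict hC ψ)
    rw [Finset.sum_pair hγ.symm, h0, hnorm] at h1
    have h2 : ‖σ.repRestrict C γ ψ‖ ^ 2 = 0 := le_antisymm (by linarith) (sq_nonneg _)
    exact norm_eq_zero.1 (pow_eq_zero_iff two_ne_zero |>.1 h2)
  refine ⟨ψ, (σ.hasSum_zak hC ψ).unique ?_⟩
  have h3 := hasSum_single (f := fun γ => pairingSMul (-γ) (σ.repRestrict C γ ψ)) 0 fun γ hγ => by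
    rw [hne γ hγ]
    exact (pairingSMulₗᵢ _ (-γ)).map_zero
  simpa only [h0, neg_zero] using h3

/-- The range is closed, being that of an isometry. It contains the constant functions and, by
intertwining, their products with characters, which are total. -/
theorem zak_surjective [SigmaFinite μ]
    (σ : QuasiInvariantAction Γ μ) {C : Set X}
    (hC : σ.IsTilingSet C) [TopologicalSpace.SeparableSpace (Lp ℂ 2 (μ.restrict C))] :
    Function.Surjective (σ.zak C) := by
  let Z := σ.zakₗᵢ hC
  have hclosed : IsClosed (Set.range Z) := Z.isometry.isClosedEmbedding.isClosed_range
  let R : ClosedSubmodule ℂ (Lp (Lp ℂ 2 (μ.restrict C)) 2 (dualHaar Γ)) :=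
    ⟨LinearMap.range Z.toLinearMap, hclosed⟩
  intro Φ
  have h0 : Φ - closedProj R Φ = 0 := by
    refine eq_zero_of_inner_pairingSMul fun γ u => ?_
    rw [← inner_conj_symm, inner_sub_closedProj, map_zero]
    obtain ⟨ψ, hψ⟩ := σ.pairingSMul_zero_mem_range_zak hC u
    refine ⟨σ.rep γ ψ, ?_⟩
    change σ.zak C (σ.rep γ ψ) = _
    rw [σ.zak_rep hC, hψ, pairingLp_smul_pairingSMul, add_zero]
  have hmem : Φ ∈ R := by
    rw [sub_eq_zero.1 h0]; exact closedProj_mem R Φ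
  exact hmem

theorem separableSpace_Lp_restrict [TopologicalSpace.SeparableSpace (Lp ℂ 2 μ)]
    {C : Set X} (hC : MeasurableSet C) :
    TopologicalSpace.SeparableSpace (Lp ℂ 2 (μ.restrict C)) := by
  refine Function.Surjective.denseRange (f := LpToLpRestrictCLM X ℂ ℂ μ 2 C) (fun u => ?_)
    |>.separableSpace (LpToLpRestrictCLM X ℂ ℂ μ 2 C).continuous
  have hL : MemLp (C.indicator u) 2 μ := (memLp_indicator_iff_restrict hC).2 (Lp.memLp u)
  refine ⟨hL.toLp _, Lp.ext ?_⟩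
  filter_upwards [LpToLpRestrictCLM_coeFn ℂ C (hL.toLp _), ae_restrict_of_ae hL.coeFn_toLp,
    ae_restrict_mem hC] with x h1 h2 h3
  rw [h1, h2, Set.indicator_of_mem h3]

/-- The length of a finitely generated invariant space is the essential supremum of the dimensions
of its Zak range function. -/
theorem length_eq_essSup [SigmaFinite μ] [TopologicalSpace.SeparableSpace (Lp ℂ 2 μ)]
    (σ : QuasiInvariantAction Γ μ) {C : Set X} (hC : σ.IsTilingSet C)
    {V : ClosedSubmodule ℂ (Lp ℂ 2 μ)} (hinv : σ.IsInvariant V) (hfg : σ.IsFinitelyGenerated V)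
    {J : DualGroup Γ → ClosedSubmodule ℂ (Lp ℂ 2 (μ.restrict C))}
    (hJ : σ.IsZakRangeFunctionOf C J V) :
    σ.length V = essSup (fun α => closedDim (J α)) (dualHaar Γ) := by
  have _ := separableSpace_Lp_restrict (μ := μ) hC.measurableSet
  let Z : Lp ℂ 2 μ ≃ₗᵢ[ℂ] Lp (Lp ℂ 2 (μ.restrict C)) 2 (dualHaar Γ) :=
    LinearIsometryEquiv.ofSurjective (σ.zakₗᵢ hC) (σ.zak_surjective hC)
  have hZ : ∀ ψ, Z ψ = σ.zak C ψ := fun _ => rfl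
  let e := Z.toContinuousLinearEquiv
  have he : ∀ ψ, e ψ = Z ψ := fun _ => rfl
  let D := Set.range (pairingLp (Γ := Γ))
  -- Intertwining matches orbits with multiples by characters, and a homeomorphic linear equivalence
  -- preserves closed spans.
  have hgen : ∀ A, multGenerated D (e '' A) = ClosedSubmodule.mapEquiv e (σ.generated A) := by
    intro A
    rw [generated, ← ClosedSubmodule.closure_map_eq_mapEquiv_closure, multGenerated,
      Submodule.map_span]
    congr 2
    ext Ψ
    constructor
    · rintro ⟨_, ⟨φ, hφ, rfl⟩, _, ⟨γ, rfl⟩, rfl⟩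
      exact ⟨σ.rep γ φ, ⟨φ, hφ, γ, rfl⟩, σ.zak_rep hC γ φ⟩
    · rintro ⟨_, ⟨φ, hφ, γ, rfl⟩, rfl⟩
      exact ⟨e φ, ⟨φ, hφ, rfl⟩, _, ⟨γ, rfl⟩, σ.zak_rep hC γ φ⟩
  let M := ClosedSubmodule.mapEquiv e V
  have hM : ∀ ψ, e ψ ∈ M ↔ ψ ∈ V := fun ψ => ClosedSubmodule.mem_mapEquiv_iff' ..
  have hgenM : ∀ A, M = multGenerated D (e '' A) ↔ V = σ.generated A := fun A => by
    rw [hgen]; exact (ClosedSubmodule.mapEquiv e).injective.eq_iff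
  have hMinv : IsMultInvariant D M := by
    rintro Φ hΦ _ ⟨γ, rfl⟩
    obtain ⟨ψ, rfl⟩ := e.surjective Φ
    have h1 : (pairingLp γ • e ψ : Lp (Lp ℂ 2 (μ.restrict C)) 2 (dualHaar Γ)) =
      e (σ.rep γ ψ) := (σ.zak_rep hC γ ψ).symm
    rw [h1, hM]
    exact hinv _ ((hM _).1 hΦ) γ
  have hMfg : IsMultFinitelyGenerated D M := by
    obtain ⟨A, hA, hVA⟩ := hfg
    exact ⟨e '' A, hA.image _, (hgenM A).2 hVA⟩
  have hMJ : IsRangeFunctionOf J M := by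
    refine ⟨hJ.1, fun Φ => ?_⟩
    obtain ⟨ψ, rfl⟩ := e.surjective Φ
    rw [hM, hJ.2]
    rfl
  rw [← multLength_eq_essSup (isDeterminingSet_range_pairingLp Γ) hMinv hMfg hMJ]
  -- Both lengths are infima of the same set, since generating families are carried over by `e` and
  -- back by its inverse.
  unfold length multLength
  congr 1
  ext k
  refine exists_congr fun n => and_congr_right fun _ => ⟨?_, ?_⟩
  · rintro ⟨φ, hφ, hV⟩
    refine ⟨fun i => e (φ i), fun i => (hM _).2 (hφ i), ?_⟩
    rw [Set.range_comp' e φ]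
    exact (hgenM _).2 hV
  · rintro ⟨Φ, hΦ, hMΦ⟩
    refine ⟨fun i => e.symm (Φ i), fun i => (hM _).1 (by simpa using hΦ i), (hgenM _).1 ?_⟩
    rw [← Set.range_comp]
    simpa [Function.comp_def] using hMΦ

end QuasiInvariantAction

end ZakTransform

end

theorem proposition4p5 :
    (∀ (Ω : Type*) [MeasurableSpace Ω] (ν : Measure Ω) [SigmaFinite ν]
      (H : Type*) [NormedAddCommGroup H] [InnerProductSpace ℂ H] [CompleteSpace H]
      [TopologicalSpace.SeparableSpace H]
      (D : Set (Lp ℂ ∞ ν)) (_ : IsDeterminingSet D)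
      (M : ClosedSubmodule ℂ (Lp H 2 ν)) (_ : IsMultInvariant D M)
      (_ : IsMultFinitelyGenerated D M)
      (J : Ω → ClosedSubmodule ℂ H) (_ : IsRangeFunctionOf J M),
      multLength D M = essSup (fun ω => closedDim (J ω)) ν) ∧
    (∀ (Γ : Type*) [AddCommGroup Γ] [TopologicalSpace Γ] [DiscreteTopology Γ] [Countable Γ]
      (X : Type*) [MeasurableSpace X] (μ : Measure X) [SigmaFinite μ]
      [TopologicalSpace.SeparableSpace (Lp ℂ 2 μ)]
      (σ : QuasiInvariantAction Γ μ) (C : Set X) (_ : σ.IsTilingSet C)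
      (V : ClosedSubmodule ℂ (Lp ℂ 2 μ)) (_ : σ.IsInvariant V)
      (_ : σ.IsFinitelyGenerated V)
      (J : DualGroup Γ → ClosedSubmodule ℂ (Lp ℂ 2 (μ.restrict C)))
      (_ : σ.IsZakRangeFunctionOf C J V),
      σ.length V = essSup (fun α => closedDim (J α)) (dualHaar Γ)) := by
  refine ⟨?_, ?_⟩
  · intro Ω _ ν _ H _ _ _ _ D hD M hinv hfg J hJ
    exact multLength_eq_essSup hD hinv hfg hJ
  · intro Γ _ _ _ _ X _ μ _ _ σ C hC V hinv hfg J hJ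
    exact σ.length_eq_essSup hC hinv hfg hJ
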